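/- Let $h:(0,1)^2\to\mathbb{R}$ be given by $$h(u_1,u_2)=1+u_1u_2\log(u_1u_2)+(1-u_1)u_2\log((1-u_1)u_2)+u_1(1-u_2)\log(u_1(1-u_2))+(1-u_1)(1-u_2)\log((1-u_1)(1-u_2)).$$ There is exactly one probability distribution on $\mathbb{R}$ with mean $0$ and finite variance that solves the 2-dimensional quad tree equation $$X\stackrel{d}{=}U_1U_2X_1+U_1(1-U_2)X_2+(1-U_1)U_2X_3+(1-U_1)(1-U_2)X_4+h(U_1,U_2),$$ where $U_1,U_2$ are uniformly distributed on $(0,1)$, $X_1,\dots,X_4$ are copies of $X$, and $U_1,U_2,X_1,\dots,X_4$ are independent. If $X$ has this distribution, then $$\lim_{x\to\infty}\frac{\log\mathbb{P}[X>x]}{x\log x}=-2\qquad\text{and}\qquad\limsup_{x\to\infty}\frac{\log\mathbb{P}[X<-x]}{x\log x}\le-\frac{2}{2\log 2-1},$$ where $\log 0=-\infty$ and the upper limit is taken in $[-\infty,\infty]$. -/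

import Mathlib

open MeasureTheory Filter Topology

noncomputable section

/-- The toll function `h(u₁, u₂)` of the 2-dimensional quad tree equation; it is only used for
`u₁, u₂ ∈ (0, 1)`. -/
def quadTreeToll (u₁ u₂ : ℝ) : ℝ :=
  1 + u₁ * u₂ * Real.log (u₁ * u₂)
    + (1 - u₁) * u₂ * Real.log ((1 - u₁) * u₂)
    + u₁ * (1 - u₂) * Real.log (u₁ * (1 - u₂))
    + (1 - u₁) * (1 - u₂) * Real.log ((1 - u₁) * (1 - u₂))

/-- The right-hand side of the quad tree equation, as a function of `((u₁, u₂), (x₁, …, x₄))`. -/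
def quadTreeRHS (p : (ℝ × ℝ) × (Fin 4 → ℝ)) : ℝ :=
  p.1.1 * p.1.2 * p.2 0
    + p.1.1 * (1 - p.1.2) * p.2 1
    + (1 - p.1.1) * p.1.2 * p.2 2
    + (1 - p.1.1) * (1 - p.1.2) * p.2 3
    + quadTreeToll p.1.1 p.1.2

theorem measurable_quadTreeRHS : Measurable quadTreeRHS := by
  unfold quadTreeRHS quadTreeToll
  fun_prop

/-- The uniform distribution on `(0, 1)`. -/
def unifLaw : Measure ℝ := volume.restrict (Set.Ioo 0 1)

/-- The smoothing transform of the quad tree equation: the law of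
`U₁ U₂ X₁ + U₁ (1 - U₂) X₂ + (1 - U₁) U₂ X₃ + (1 - U₁) (1 - U₂) X₄ + h(U₁, U₂)`, where
`U₁, U₂` are uniform on `(0, 1)`, `X₁, …, X₄` have law `ν`, and all six are independent. -/
def quadTreeTransform (ν : Measure ℝ) : Measure ℝ :=
  Measure.map quadTreeRHS ((unifLaw.prod unifLaw).prod (Measure.pi fun _ : Fin 4 => ν))

/-- `ν` is the law of a solution `X` of the 2-dimensional quad tree equation with mean `0` and
finite variance. -/
structure IsQuadTreeLaw (ν : Measure ℝ) : Prop where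
  isProbabilityMeasure : IsProbabilityMeasure ν
  memLp_two : MemLp (fun x : ℝ => x) 2 ν
  mean_zero : ∫ x, x ∂ν = 0
  fixedPoint : quadTreeTransform ν = ν

end

/-! The four areas sum to one and the toll splits as b(u) + b(v), where b = 1/2 - binary entropy is
centred with values in [1/2 - log 2, 1/2]. The two tail constants are the reciprocals of a = 1/2 and
a = log 2 - 1/2, the suprema of b and of -b.

Upper tails: the bound E exp(σsX) ≤ exp(K(s)) with K(s) = 10000 (exp(as) - 1 - as) is preserved by
the smoothing transform (`HasMGFBound.quadTreeTransform`). Superadditivity of exp - 1 over the areas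
leaves a gap that dominates, after integration, the exponential of the toll
(`integral_exp_sub_le_one`). Chernoff's inequality then gives decay exp(-x log x / a + O(x)), so the
large factor 10000 is harmless.

Existence and uniqueness: on centred laws the transform contracts sup |φ(t) - ψ(t)| / t² of
characteristic functions by the expected sum of squared areas, 4/9. The iterates from the point mass
at 0 are tight by the moment bounds, which pass to the limit and, by uniqueness, hold for every
solution.

Lower bound on the right tail: if both uniforms exceed 1 - δ, the first summand is kept almost whole
and the toll is almost 1. Repeating this n ≈ x times with δ of order 1/n costs about n^(-2n), which
matches the upper bound 1/a = 2. -/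

/-! ### Splitting of the toll and one-dimensional integrals. -/

theorem quadTreeToll_eq {u v : ℝ} (hu : u ∈ Set.Ioo (0 : ℝ) 1) (hv : v ∈ Set.Ioo (0 : ℝ) 1) :
    quadTreeToll u v = (1 / 2 - Real.binEntropy u) + (1 / 2 - Real.binEntropy v) := by
  have h1 : u ≠ 0 := hu.1.ne'
  have h2 : v ≠ 0 := hv.1.ne'
  have h3 : 1 - u ≠ 0 := by linarith [hu.2]
  have h4 : 1 - v ≠ 0 := by linarith [hv.2]
  rw [quadTreeToll, Real.log_mul h1 h2, Real.log_mul h3 h2, Real.log_mul h1 h4,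
    Real.log_mul h3 h4, Real.binEntropy_eq_negMulLog_add_negMulLog_one_sub,
    Real.binEntropy_eq_negMulLog_add_negMulLog_one_sub]
  simp only [Real.negMulLog]
  ring

theorem integral_unifLaw (f : ℝ → ℝ) : ∫ u, f u ∂unifLaw = ∫ u in (0 : ℝ)..1, f u := by
  rw [unifLaw, intervalIntegral.integral_of_le zero_le_one, integral_Ioc_eq_integral_Ioo]

instance isProbabilityMeasure_unifLaw : IsProbabilityMeasure unifLaw :=
  ⟨by simp [unifLaw]⟩

theorem ae_unifLaw_mem_Ioo : ∀ᵐ u ∂unifLaw, u ∈ Set.Ioo (0 : ℝ) 1 :=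
  ae_restrict_mem measurableSet_Ioo

theorem integrable_unifLaw {f : ℝ → ℝ} (hf : Continuous f) : Integrable f unifLaw :=
  (hf.continuousOn.integrableOn_Icc (a := 0) (b := 1)).mono_set Set.Ioo_subset_Icc_self

theorem integral_binEntropy : ∫ u in (0 : ℝ)..1, Real.binEntropy u = 1 / 2 := by
  have h1 : ∫ u in (0 : ℝ)..1, Real.negMulLog u = 1 / 4 := by
    -- The derivative is only needed in the open interval; at 0, where the logarithm is singular,
    -- continuity of the antiderivative suffices.
    have hd : ∀ x ∈ Set.Ioo (0 : ℝ) 1,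
        HasDerivAt (fun u : ℝ => u * Real.negMulLog u / 2 + u ^ 2 / 4) (Real.negMulLog x) x := by
      intro x hx
      have h := (((hasDerivAt_id x).mul (Real.hasDerivAt_negMulLog hx.1.ne')).div_const 2).add
        (((hasDerivAt_id x).pow 2).div_const 4)
      refine h.congr_deriv ?_
      simp [Real.negMulLog]
      ring
    rw [intervalIntegral.integral_eq_sub_of_hasDerivAt_of_le zero_le_one (by fun_prop) hd
      (by apply Continuous.intervalIntegrable; fun_prop)]
    simp
  have h2 : ∫ u in (0 : ℝ)..1, Real.negMulLog (1 - u) = 1 / 4 := by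
    rw [intervalIntegral.integral_comp_sub_left (fun u => Real.negMulLog u)]
    simpa using h1
  simp_rw [Real.binEntropy_eq_negMulLog_add_negMulLog_one_sub]
  rw [intervalIntegral.integral_add (by apply Continuous.intervalIntegrable; fun_prop)
    (by apply Continuous.intervalIntegrable; fun_prop), h1, h2]
  norm_num

theorem integral_mul_one_sub : ∫ u in (0 : ℝ)..1, u * (1 - u) = 1 / 6 := by
  simp_rw [mul_sub, mul_one, ← pow_two]
  rw [intervalIntegral.integral_sub (by simp) (by simp)]
  simp [integral_pow]
  norm_num

theorem integral_exp_neg_mul_le {c : ℝ} (hc : 0 < c) :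
    ∫ u in (0 : ℝ)..1, Real.exp (-(c * u)) ≤ 1 / c := by
  have hd : ∀ x ∈ Set.uIcc (0 : ℝ) 1,
      HasDerivAt (fun u : ℝ => -Real.exp (-(c * u)) / c) (Real.exp (-(c * x))) x := by
    intro x _
    have h := ((((hasDerivAt_id x).const_mul c).neg.exp).neg).div_const c
    refine h.congr_deriv ?_
    simp
    field_simp
  rw [intervalIntegral.integral_eq_sub_of_hasDerivAt hd
    (by apply Continuous.intervalIntegrable; fun_prop)]
  simp only [mul_zero, neg_zero, Real.exp_zero, mul_one]
  have := Real.exp_pos (-c)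
  rw [← sub_div, div_le_div_iff_of_pos_right hc]
  linarith

/-- One-dimensional exponential moment estimate behind the moment generating function bound. -/
theorem integral_exp_sub_le_one {b : ℝ → ℝ} (hb : Continuous b) {a s : ℝ} (ha : 1 / 6 ≤ a)
    (hs : 0 ≤ s) (hb_abs : ∀ u ∈ Set.Icc (0 : ℝ) 1, |b u| ≤ 1 / 2)
    (hb_le : ∀ u ∈ Set.Icc (0 : ℝ) 1, b u ≤ a) (hb_mean : ∫ u in (0 : ℝ)..1, b u = 0) :
    ∫ u in (0 : ℝ)..1,
      Real.exp (s * b u - 10000 * (Real.exp (a * s / 2) - 1) ^ 2 * (u * (1 - u))) ≤ 1 := by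
  set z := Real.exp (a * s / 2) with hz
  set c := 10000 * (z - 1) ^ 2 with hc
  have hz0 : a * s / 2 + 1 ≤ z := Real.add_one_le_exp _
  have hzz : Real.exp (a * s) = z ^ 2 := by
    rw [hz, ← Real.exp_nat_mul]; congr 1; push_cast; ring
  have hzpos : 0 < z := Real.exp_pos _
  have has : 0 ≤ a * s := by positivity
  -- If the penalty c is large, b can be replaced by its maximum a. Since u(1-u) ≥ min(u, 1-u)/2,
  -- the integral is then at most z² · 4/c. Otherwise z is close to 1, s is small, and a
  -- second-order expansion can use that b has mean zero.
  by_cases hcase : 4 * z ^ 2 ≤ c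
  · have hcpos : 0 < c := by nlinarith
    have hpt : ∀ u ∈ Set.Icc (0 : ℝ) 1, Real.exp (s * b u - c * (u * (1 - u))) ≤
        z ^ 2 * (Real.exp (-(c / 2 * u)) + Real.exp (-(c / 2 * (1 - u)))) := by
      intro u hu
      rw [sub_eq_add_neg, Real.exp_add]
      refine mul_le_mul ?_ ?_ (Real.exp_pos _).le (by positivity)
      · rw [← hzz]
        exact Real.exp_le_exp.2 (by nlinarith [hb_le u hu])
      · rcases le_total u (1 / 2) with h | h
        · refine (Real.exp_le_exp.2 ?_).trans (le_add_of_nonneg_right (Real.exp_pos _).le)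
          nlinarith [mul_nonneg hcpos.le hu.1]
        · refine (Real.exp_le_exp.2 ?_).trans (le_add_of_nonneg_left (Real.exp_pos _).le)
          nlinarith [mul_nonneg hcpos.le (sub_nonneg.2 hu.2)]
    refine (intervalIntegral.integral_mono_on zero_le_one
      (by apply Continuous.intervalIntegrable; fun_prop)
      (by apply Continuous.intervalIntegrable; fun_prop) hpt).trans ?_
    rw [intervalIntegral.integral_const_mul, intervalIntegral.integral_add
      (by apply Continuous.intervalIntegrable; fun_prop)
      (by apply Continuous.intervalIntegrable; fun_prop),
      intervalIntegral.integral_comp_sub_left (fun u => Real.exp (-(c / 2 * u)))]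
    simp only [sub_self, sub_zero]
    have h := integral_exp_neg_mul_le (half_pos hcpos)
    calc z ^ 2 * _ ≤ z ^ 2 * (1 / (c / 2) + 1 / (c / 2)) := by gcongr
      _ = 4 * z ^ 2 / c := by field_simp; norm_num
      _ ≤ 1 := by rwa [div_le_one hcpos]
  · push Not at hcase
    have hz1 : z ≤ 1.03 := by
      by_contra! h
      nlinarith
    have hc5 : c ≤ 5 := by nlinarith
    have hc0 : 0 ≤ c := by positivity
    have hs1 : s ≤ 1 / 2 := by nlinarith
    -- The factor 9 is what the end requires: the quadratic error s²/4 must be absorbed by c/6 · ∫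
    -- u(1-u) = c/36. The bound 1/6 ≤ a enters through s/12 ≤ as/2 ≤ z - 1.
    have hcs : 9 * s ^ 2 ≤ c := by
      have h1 : s / 12 ≤ z - 1 := by nlinarith
      have h2 : (s / 12) ^ 2 ≤ (z - 1) ^ 2 := by gcongr
      nlinarith [sq_nonneg s]
    have hpt : ∀ u ∈ Set.Icc (0 : ℝ) 1, Real.exp (s * b u - c * (u * (1 - u))) ≤
        1 + s * b u + s ^ 2 / 4 - c / 6 * (u * (1 - u)) := by
      intro u hu
      obtain ⟨hb1, hb2⟩ := abs_le.1 (hb_abs u hu)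
      have hw0 : 0 ≤ u * (1 - u) := mul_nonneg hu.1 (sub_nonneg.2 hu.2)
      have hw1 : u * (1 - u) ≤ 1 / 4 := by nlinarith [sq_nonneg (u - 1 / 2)]
      set y := c * (u * (1 - u)) with hy
      have hy0 : 0 ≤ y := by positivity
      have hy2 : y ≤ 2 := by nlinarith
      have hsb1 : -(1 / 4) ≤ s * b u := by nlinarith
      have hsb2 : s * b u ≤ 1 / 4 := by nlinarith
      have hsq : (s * b u) ^ 2 ≤ s ^ 2 / 4 := by
        have hbu : b u ^ 2 ≤ 1 / 4 := by nlinarith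
        rw [mul_pow]
        nlinarith [mul_le_mul_of_nonneg_left hbu (sq_nonneg s)]
      have he1 : Real.exp (s * b u) ≤ 1 + s * b u + (s * b u) ^ 2 := by
        have := (abs_le.1 (Real.abs_exp_sub_one_sub_id_le
          (x := s * b u) (abs_le.2 ⟨by linarith, by linarith⟩))).2
        linarith
      -- This is 1/(1+y) ≤ 1 - y/3, valid exactly because 0 ≤ y ≤ 2.
      have he2 : Real.exp (-y) ≤ 1 - y / 3 := by
        rw [Real.exp_neg]
        have h1 := Real.add_one_le_exp y
        refine (inv_anti₀ (by linarith) h1).trans ?_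
        rw [inv_le_iff_one_le_mul₀ (by linarith)]
        nlinarith
      rw [sub_eq_add_neg, Real.exp_add]
      calc _ ≤ (1 + s * b u + (s * b u) ^ 2) * (1 - y / 3) :=
            mul_le_mul he1 he2 (Real.exp_pos _).le (by nlinarith)
        _ ≤ 1 + s * b u + s ^ 2 / 4 - y / 6 := by
            nlinarith [mul_nonneg hy0 (sq_nonneg (s * b u)),
              mul_nonneg hy0 (by linarith : 0 ≤ s * b u + 1 / 4)]
        _ = _ := by rw [hy]; ring
    refine (intervalIntegral.integral_mono_on zero_le_one
      (by apply Continuous.intervalIntegrable; fun_prop)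
      (by apply Continuous.intervalIntegrable; fun_prop) hpt).trans ?_
    rw [intervalIntegral.integral_sub (by apply Continuous.intervalIntegrable; fun_prop)
      (by apply Continuous.intervalIntegrable; fun_prop),
      intervalIntegral.integral_add (by apply Continuous.intervalIntegrable; fun_prop)
      (by apply Continuous.intervalIntegrable; fun_prop),
      intervalIntegral.integral_add (by apply Continuous.intervalIntegrable; fun_prop)
      (by apply Continuous.intervalIntegrable; fun_prop),
      intervalIntegral.integral_const_mul, intervalIntegral.integral_const_mul, hb_mean,
      integral_mul_one_sub]
    simp
    linarith

/-! ### Quantitative superadditivity and invariance of the exponential moment bound. -/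

/-- For w ≤ 1/2, the points xw and x(1-w) lie on the segments from 0 and from x to the midpoint x/2.
The two chord bounds add up to a gap of 2w (exp(x/2) - 1)²; the other half follows by symmetry. -/
theorem exp_sub_exp_sub_exp_ge {x u : ℝ} (hu : u ∈ Set.Icc (0 : ℝ) 1) :
    2 * (u * (1 - u)) * (Real.exp (x / 2) - 1) ^ 2 ≤
      Real.exp x + 1 - Real.exp (x * u) - Real.exp (x * (1 - u)) := by
  have key : ∀ w ∈ Set.Icc (0 : ℝ) (1 / 2), 2 * (w * (1 - w)) * (Real.exp (x / 2) - 1) ^ 2 ≤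
      Real.exp x + 1 - Real.exp (x * w) - Real.exp (x * (1 - w)) := by
    intro w hw
    have hxx : Real.exp x = Real.exp (x / 2) ^ 2 := by
      rw [← Real.exp_nat_mul]; congr 1; push_cast; ring
    have h1 := convexOn_exp.2 (Set.mem_univ 0) (Set.mem_univ (x / 2))
      (by linarith [hw.2] : 0 ≤ 1 - 2 * w) (by linarith [hw.1] : 0 ≤ 2 * w) (by ring)
    have h2 := convexOn_exp.2 (Set.mem_univ x) (Set.mem_univ (x / 2))
      (by linarith [hw.2] : 0 ≤ 1 - 2 * w) (by linarith [hw.1] : 0 ≤ 2 * w) (by ring)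
    simp only [smul_eq_mul, Real.exp_zero] at h1 h2
    rw [show (1 - 2 * w) * 0 + 2 * w * (x / 2) = x * w by ring] at h1
    rw [show (1 - 2 * w) * x + 2 * w * (x / 2) = x * (1 - w) by ring] at h2
    have h3 : 0 ≤ w ^ 2 * (Real.exp (x / 2) - 1) ^ 2 := by positivity
    rw [hxx] at h2 ⊢
    nlinarith
  rcases le_total u (1 / 2) with h | h
  · exact key u ⟨hu.1, h⟩
  · have := key (1 - u) ⟨by linarith [hu.2], by linarith⟩
    rw [sub_sub_cancel] at this
    linarith

/-- The bound `10000 (exp (a s) - 1 - a s)` for the logarithm of a moment generating function. -/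
noncomputable def cgfBound (a s : ℝ) : ℝ := 10000 * (Real.exp (a * s) - 1 - a * s)

/-- The moment generating function of `μ` at `σ s`, `s ≥ 0`, is at most `exp (cgfBound a s)`. -/
def HasMGFBound (σ a : ℝ) (μ : Measure ℝ) : Prop :=
  ∀ s : ℝ, 0 ≤ s →
    ∫⁻ x, ENNReal.ofReal (Real.exp (σ * s * x)) ∂μ ≤ ENNReal.ofReal (Real.exp (cgfBound a s))

/-- Since the bound is stated with the lower Lebesgue integral, it carries finiteness with it. -/
theorem HasMGFBound.integrable {σ a : ℝ} {μ : Measure ℝ} (h : HasMGFBound σ a μ) {s : ℝ}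
    (hs : 0 ≤ s) : Integrable (fun x => Real.exp (σ * s * x)) μ := by
  refine ⟨by fun_prop, ?_⟩
  rw [hasFiniteIntegral_iff_ofReal (ae_of_all _ fun x => (Real.exp_pos _).le)]
  exact (h s hs).trans_lt ENNReal.ofReal_lt_top

theorem HasMGFBound.integral_le {σ a : ℝ} {μ : Measure ℝ} (h : HasMGFBound σ a μ) {s : ℝ}
    (hs : 0 ≤ s) : ∫ x, Real.exp (σ * s * x) ∂μ ≤ Real.exp (cgfBound a s) := by
  have := h s hs
  rwa [← ofReal_integral_eq_lintegral_ofReal (h.integrable hs)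
    (ae_of_all _ fun x => (Real.exp_pos _).le),
    ENNReal.ofReal_le_ofReal_iff (Real.exp_pos _).le] at this

theorem HasMGFBound.lintegral_pi_le {σ a : ℝ} {μ : Measure ℝ} [IsProbabilityMeasure μ]
    (h : HasMGFBound σ a μ) {s : Fin 4 → ℝ} (hs : ∀ i, 0 ≤ s i) :
    ∫⁻ x, ENNReal.ofReal (∏ i, Real.exp (σ * s i * x i)) ∂(Measure.pi fun _ : Fin 4 => μ) ≤
      ENNReal.ofReal (Real.exp (∑ i, cgfBound a (s i))) := by
  have hint : Integrable (fun x : Fin 4 → ℝ => ∏ i, Real.exp (σ * s i * x i))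
      (Measure.pi fun _ => μ) :=
    Integrable.fintype_prod (f := fun i x => Real.exp (σ * s i * x))
      fun i => h.integrable (hs i)
  rw [← ofReal_integral_eq_lintegral_ofReal hint
    (ae_of_all _ fun x => Finset.prod_nonneg fun i _ => (Real.exp_pos _).le)]
  refine ENNReal.ofReal_le_ofReal ?_
  rw [integral_fintype_prod_eq_prod (fun i x => Real.exp (σ * s i * x)), Real.exp_sum]
  exact Finset.prod_le_prod (fun i _ => integral_nonneg fun x => (Real.exp_pos _).le)
    fun i _ => h.integral_le (hs i)

/-- The centred one-dimensional toll. -/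
noncomputable def entropyToll (u : ℝ) : ℝ := 1 / 2 - Real.binEntropy u

theorem continuous_entropyToll : Continuous entropyToll := by
  unfold entropyToll; fun_prop

theorem entropyToll_le {u : ℝ} (hu : u ∈ Set.Icc (0 : ℝ) 1) : entropyToll u ≤ 1 / 2 := by
  have := Real.binEntropy_nonneg hu.1 hu.2
  unfold entropyToll; linarith

theorem neg_entropyToll_le (u : ℝ) : -entropyToll u ≤ Real.log 2 - 1 / 2 := by
  have := Real.binEntropy_le_log_two (p := u)
  unfold entropyToll; linarith

theorem abs_entropyToll_le {u : ℝ} (hu : u ∈ Set.Icc (0 : ℝ) 1) : |entropyToll u| ≤ 1 / 2 := by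
  rw [abs_le]
  exact ⟨by linarith [neg_entropyToll_le u, Real.log_two_lt_d9], entropyToll_le hu⟩

theorem integral_entropyToll : ∫ u in (0 : ℝ)..1, entropyToll u = 0 := by
  unfold entropyToll
  rw [intervalIntegral.integral_sub (by simp)
    (Real.binEntropy_continuous.intervalIntegrable _ _), integral_binEntropy]
  simp

/-- The sign `σ` and the growth rate `a` belong together: `a` bounds `σ` times the toll. -/
structure IsTollBound (σ a : ℝ) : Prop where
  abs_le : |σ| ≤ 1
  le : 1 / 6 ≤ a
  toll_le : ∀ u ∈ Set.Icc (0 : ℝ) 1, σ * entropyToll u ≤ a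

theorem isTollBound_one : IsTollBound 1 (1 / 2) :=
  ⟨by simp, by norm_num, fun u hu => by simpa using entropyToll_le hu⟩

theorem isTollBound_neg_one : IsTollBound (-1) (Real.log 2 - 1 / 2) :=
  ⟨by simp, by linarith [Real.log_two_gt_d9], fun u _ => by simpa using neg_entropyToll_le u⟩

/-- The gap in the superadditivity of `exp - 1` for the four areas. -/
theorem exp_sub_sum_exp_ge {x u v : ℝ} (hu : u ∈ Set.Icc (0 : ℝ) 1)
    (hv : v ∈ Set.Icc (0 : ℝ) 1) :
    (u * (1 - u) + v * (1 - v)) * (Real.exp (x / 2) - 1) ^ 2 ≤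
      Real.exp x + 3 - Real.exp (x * (u * v)) - Real.exp (x * (u * (1 - v)))
        - Real.exp (x * ((1 - u) * v)) - Real.exp (x * ((1 - u) * (1 - v))) := by
  have nn : ∀ y : ℝ, ∀ w ∈ Set.Icc (0 : ℝ) 1,
      0 ≤ Real.exp y + 1 - Real.exp (y * w) - Real.exp (y * (1 - w)) := fun y w hw =>
    le_trans (mul_nonneg (mul_nonneg zero_le_two (mul_nonneg hw.1 (sub_nonneg.2 hw.2)))
      (sq_nonneg _)) (exp_sub_exp_sub_exp_ge hw)
  -- Cutting first by u and then by v gives the gap 2u(1-u); cutting in the other order gives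
  -- 2v(1-v). The claim is the average of the two, the second cuts contributing only nonnegative
  -- terms.
  have h1 := exp_sub_exp_sub_exp_ge (x := x) hu
  have h2 := exp_sub_exp_sub_exp_ge (x := x) hv
  have h3 := nn (x * u) v hv
  have h4 := nn (x * (1 - u)) v hv
  have h5 := nn (x * v) u hu
  have h6 := nn (x * (1 - v)) u hu
  rw [show x * v * u = x * (u * v) by ring, show x * v * (1 - u) = x * ((1 - u) * v) by ring] at h5
  rw [show x * (1 - v) * u = x * (u * (1 - v)) by ring,
    show x * (1 - v) * (1 - u) = x * ((1 - u) * (1 - v)) by ring] at h6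
  simp only [mul_assoc] at h3 h4
  nlinarith

/-- The areas of the four quadrants. -/
def quadrantArea (u v : ℝ) : Fin 4 → ℝ :=
  ![u * v, u * (1 - v), (1 - u) * v, (1 - u) * (1 - v)]

theorem quadrantArea_nonneg {u v : ℝ} (hu : u ∈ Set.Icc (0 : ℝ) 1) (hv : v ∈ Set.Icc (0 : ℝ) 1)
    (i : Fin 4) : 0 ≤ quadrantArea u v i := by
  have := sub_nonneg.2 hu.2
  have := sub_nonneg.2 hv.2
  have := hu.1
  have := hv.1
  fin_cases i <;> simp [quadrantArea] <;> positivity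

theorem quadTreeRHS_eq (u v : ℝ) (x : Fin 4 → ℝ) :
    quadTreeRHS ((u, v), x) = (∑ i, quadrantArea u v i * x i) + quadTreeToll u v := by
  simp [quadTreeRHS, quadrantArea, Fin.sum_univ_four]

/-- As the areas sum to one, the linear terms of K reproduce themselves and only the exponential gap
remains. Both gap and toll are sums of a function of u and one of v, so the exponential factorizes.
-/
theorem sum_cgfBound_le {σ a : ℝ} {u v : ℝ} (hu : u ∈ Set.Ioo (0 : ℝ) 1)
    (hv : v ∈ Set.Ioo (0 : ℝ) 1) (s : ℝ) :
    σ * s * quadTreeToll u v + ∑ i, cgfBound a (s * quadrantArea u v i) ≤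
      cgfBound a s
        + (s * (σ * entropyToll u) - 10000 * (Real.exp (a * s / 2) - 1) ^ 2 * (u * (1 - u)))
        + (s * (σ * entropyToll v) - 10000 * (Real.exp (a * s / 2) - 1) ^ 2 * (v * (1 - v))) := by
  have h := exp_sub_sum_exp_ge (x := a * s) (Set.Ioo_subset_Icc_self hu)
    (Set.Ioo_subset_Icc_self hv)
  rw [quadTreeToll_eq hu hv]
  simp only [Fin.sum_univ_four, cgfBound, quadrantArea, entropyToll, Matrix.cons_val,
    ← mul_assoc] at h ⊢
  linarith

theorem lintegral_quadTreeTransform {μ : Measure ℝ} [IsProbabilityMeasure μ] {f : ℝ → ENNReal}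
    (hf : Measurable f) : ∫⁻ x, f x ∂(quadTreeTransform μ) =
      ∫⁻ u, ∫⁻ v, ∫⁻ x, f (quadTreeRHS ((u, v), x)) ∂(Measure.pi fun _ : Fin 4 => μ)
        ∂unifLaw ∂unifLaw := by
  have hm : Measurable fun p => f (quadTreeRHS p) := hf.comp measurable_quadTreeRHS
  rw [quadTreeTransform, lintegral_map hf measurable_quadTreeRHS, lintegral_prod _ hm.aemeasurable,
    lintegral_prod _ hm.lintegral_prod_right'.aemeasurable]

theorem lintegral_exp_entropyToll_le {σ a s : ℝ} (h : IsTollBound σ a) (hs : 0 ≤ s) :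
    ∫⁻ u, ENNReal.ofReal (Real.exp (s * (σ * entropyToll u)
      - 10000 * (Real.exp (a * s / 2) - 1) ^ 2 * (u * (1 - u)))) ∂unifLaw ≤ 1 := by
  have hc := continuous_entropyToll
  rw [← ofReal_integral_eq_lintegral_ofReal (integrable_unifLaw (by fun_prop))
    (ae_of_all _ fun x => (Real.exp_pos _).le), integral_unifLaw]
  refine ENNReal.ofReal_le_one.2 ?_
  refine integral_exp_sub_le_one (b := fun u => σ * entropyToll u) (by fun_prop) h.le hs
    (fun u hu => ?_) h.toll_le ?_
  · rw [abs_mul]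
    nlinarith [abs_entropyToll_le hu, h.abs_le, abs_nonneg σ, abs_nonneg (entropyToll u)]
  · rw [intervalIntegral.integral_const_mul, integral_entropyToll, mul_zero]

/-- Given (u, v), independence bounds the conditional moment by exp(K(s)) F(u) F(v), and F has
integral at most 1. -/
theorem HasMGFBound.quadTreeTransform {σ a : ℝ} (hσ : IsTollBound σ a) {μ : Measure ℝ}
    [IsProbabilityMeasure μ] (h : HasMGFBound σ a μ) :
    HasMGFBound σ a (quadTreeTransform μ) := by
  intro s hs
  set F : ℝ → ENNReal := fun u => ENNReal.ofReal (Real.exp (s * (σ * entropyToll u)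
      - 10000 * (Real.exp (a * s / 2) - 1) ^ 2 * (u * (1 - u)))) with hF
  have hFm : Measurable F := by
    have := continuous_entropyToll
    fun_prop
  have key : ∀ u ∈ Set.Ioo (0 : ℝ) 1, ∀ v ∈ Set.Ioo (0 : ℝ) 1,
      ∫⁻ x, ENNReal.ofReal (Real.exp (σ * s * quadTreeRHS ((u, v), x)))
        ∂(Measure.pi fun _ : Fin 4 => μ) ≤ ENNReal.ofReal (Real.exp (cgfBound a s)) * F u * F v := by
    intro u hu v hv
    have he : ∀ x : Fin 4 → ℝ, ENNReal.ofReal (Real.exp (σ * s * quadTreeRHS ((u, v), x))) =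
        ENNReal.ofReal (Real.exp (σ * s * quadTreeToll u v)) *
          ENNReal.ofReal (∏ i, Real.exp (σ * (s * quadrantArea u v i) * x i)) := by
      intro x
      rw [← ENNReal.ofReal_mul (Real.exp_pos _).le, ← Real.exp_sum, ← Real.exp_add,
        quadTreeRHS_eq, mul_add, Finset.mul_sum, add_comm]
      simp only [mul_assoc]
    simp_rw [he]
    rw [lintegral_const_mul _ (by fun_prop)]
    refine (mul_le_mul_right (h.lintegral_pi_le fun i => mul_nonneg hs (quadrantArea_nonneg
      (Set.Ioo_subset_Icc_self hu) (Set.Ioo_subset_Icc_self hv) i)) _).trans ?_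
    simp only [hF]
    rw [← ENNReal.ofReal_mul (Real.exp_pos _).le, ← ENNReal.ofReal_mul (Real.exp_pos _).le,
      ← ENNReal.ofReal_mul (by positivity), ← Real.exp_add, ← Real.exp_add, ← Real.exp_add]
    exact ENNReal.ofReal_le_ofReal (Real.exp_le_exp.2 (sum_cgfBound_le hu hv s))
  rw [lintegral_quadTreeTransform (by fun_prop)]
  calc _ ≤ ∫⁻ u, ∫⁻ v, ENNReal.ofReal (Real.exp (cgfBound a s)) * F u * F v ∂unifLaw ∂unifLaw := by
        refine lintegral_mono_ae ?_
        filter_upwards [ae_unifLaw_mem_Ioo] with u hu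
        refine lintegral_mono_ae ?_
        filter_upwards [ae_unifLaw_mem_Ioo] with v hv using key u hu v hv
    _ = ENNReal.ofReal (Real.exp (cgfBound a s)) * (∫⁻ u, F u ∂unifLaw) *
        ∫⁻ u, F u ∂unifLaw := by
        simp_rw [lintegral_const_mul _ hFm]
        rw [lintegral_mul_const _ (by fun_prop), lintegral_const_mul _ hFm]
    _ ≤ ENNReal.ofReal (Real.exp (cgfBound a s)) * 1 * 1 := by
        gcongr <;> exact lintegral_exp_entropyToll_le hσ hs
    _ = _ := by simp

/-! ### Contraction of characteristic functions and uniqueness. -/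

theorem quadTreeTransform_isProbabilityMeasure (μ : Measure ℝ) [IsProbabilityMeasure μ] :
    IsProbabilityMeasure (quadTreeTransform μ) :=
  Measure.isProbabilityMeasure_map measurable_quadTreeRHS.aemeasurable

theorem measurable_quadrantArea (i : Fin 4) :
    Measurable fun p : ℝ × ℝ => quadrantArea p.1 p.2 i := by
  fin_cases i <;> simp [quadrantArea] <;> fun_prop

theorem measurable_quadTreeToll : Measurable fun p : ℝ × ℝ => quadTreeToll p.1 p.2 := by
  unfold quadTreeToll
  fun_prop

theorem integrable_charFun_integrand (μ : Measure ℝ) [IsProbabilityMeasure μ] (t : ℝ) :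
    Integrable (fun p : ℝ × ℝ => Complex.exp (t * quadTreeToll p.1 p.2 * Complex.I) *
      ∏ i, charFun μ (t * quadrantArea p.1 p.2 i)) (unifLaw.prod unifLaw) := by
  have h1 := measurable_quadTreeToll
  have h2 : ∀ i, Measurable fun p : ℝ × ℝ => charFun μ (t * quadrantArea p.1 p.2 i) :=
    fun i => measurable_charFun.comp ((measurable_quadrantArea i).const_mul t)
  refine Integrable.of_bound (C := 1) (by fun_prop) (ae_of_all _ fun p => ?_)
  rw [norm_mul, ← Complex.ofReal_mul, Complex.norm_exp_ofReal_mul_I, one_mul, norm_prod]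
  exact Finset.prod_le_one (fun i _ => norm_nonneg _) fun i _ => norm_charFun_le_one _

theorem charFun_quadTreeTransform (μ : Measure ℝ) [IsProbabilityMeasure μ] (t : ℝ) :
    charFun (quadTreeTransform μ) t =
      ∫ p : ℝ × ℝ, Complex.exp (t * quadTreeToll p.1 p.2 * Complex.I) *
        ∏ i, charFun μ (t * quadrantArea p.1 p.2 i) ∂(unifLaw.prod unifLaw) := by
  have hm := measurable_quadTreeRHS
  rw [charFun_apply_real, quadTreeTransform, integral_map hm.aemeasurable (by fun_prop),
    integral_prod]
  · refine integral_congr_ae (ae_of_all _ fun p => ?_)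
    simp only
    simp_rw [charFun_apply_real]
    rw [← integral_fintype_prod_eq_prod
      (fun i (x : ℝ) => Complex.exp (((t * quadrantArea p.1 p.2 i : ℝ) : ℂ) * x * Complex.I)),
      ← integral_const_mul]
    refine integral_congr_ae (ae_of_all _ fun x => ?_)
    simp only
    rw [quadTreeRHS_eq, ← Complex.exp_sum, ← Complex.exp_add, ← Finset.sum_mul]
    congr 1
    push_cast
    simp_rw [mul_assoc (t : ℂ), ← Finset.mul_sum]
    ring
  · refine Integrable.of_bound (C := 1) (by fun_prop) (ae_of_all _ fun p => ?_)
    rw [← Complex.ofReal_mul, Complex.norm_exp_ofReal_mul_I]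

theorem norm_prod_sub_prod_le_sum {ι : Type*} (s : Finset ι) {f g : ι → ℂ}
    (hf : ∀ i, ‖f i‖ ≤ 1) (hg : ∀ i, ‖g i‖ ≤ 1) :
    ‖∏ i ∈ s, f i - ∏ i ∈ s, g i‖ ≤ ∑ i ∈ s, ‖f i - g i‖ := by
  classical
  induction s using Finset.induction_on with
  | empty => simp
  | insert a s ha ih =>
    rw [Finset.prod_insert ha, Finset.prod_insert ha, Finset.sum_insert ha]
    have hg' : ‖∏ i ∈ s, g i‖ ≤ 1 := by
      rw [norm_prod]; exact Finset.prod_le_one (fun i _ => norm_nonneg _) fun i _ => hg i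
    calc ‖f a * ∏ i ∈ s, f i - g a * ∏ i ∈ s, g i‖
        = ‖f a * (∏ i ∈ s, f i - ∏ i ∈ s, g i) + (f a - g a) * ∏ i ∈ s, g i‖ := by ring_nf
      _ ≤ ‖f a‖ * ‖∏ i ∈ s, f i - ∏ i ∈ s, g i‖ + ‖f a - g a‖ * ‖∏ i ∈ s, g i‖ := by
          rw [← norm_mul, ← norm_mul]; exact norm_add_le _ _
      _ ≤ 1 * (∑ i ∈ s, ‖f i - g i‖) + ‖f a - g a‖ * 1 := by
          gcongr
          exact hf a
      _ = _ := by ring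

theorem integral_sum_quadrantArea_sq :
    Integrable (fun p : ℝ × ℝ => ∑ i, quadrantArea p.1 p.2 i ^ 2) (unifLaw.prod unifLaw) ∧
    ∫ p : ℝ × ℝ, ∑ i, quadrantArea p.1 p.2 i ^ 2 ∂(unifLaw.prod unifLaw) = 4 / 9 := by
  have he : (fun p : ℝ × ℝ => ∑ i, quadrantArea p.1 p.2 i ^ 2) =
      fun p => (p.1 ^ 2 + (1 - p.1) ^ 2) * (p.2 ^ 2 + (1 - p.2) ^ 2) := by
    ext p
    simp [quadrantArea, Fin.sum_univ_four]
    ring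
  have h1 : Integrable (fun u : ℝ => u ^ 2 + (1 - u) ^ 2) unifLaw :=
    integrable_unifLaw (by fun_prop)
  have h2 : ∫ u, (u ^ 2 + (1 - u) ^ 2) ∂unifLaw = 2 / 3 := by
    rw [integral_unifLaw, intervalIntegral.integral_add
      (by apply Continuous.intervalIntegrable; fun_prop)
      (by apply Continuous.intervalIntegrable; fun_prop),
      intervalIntegral.integral_comp_sub_left (fun u : ℝ => u ^ 2)]
    simp [integral_pow]
    norm_num
  rw [he]
  refine ⟨h1.mul_prod h1, ?_⟩
  rw [integral_prod_mul (fun u : ℝ => u ^ 2 + (1 - u) ^ 2) (fun u : ℝ => u ^ 2 + (1 - u) ^ 2), h2]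
  norm_num

/-- The toll contributes only a unimodular factor, and a difference of products of numbers in the
unit disc is at most the sum of the differences. Each of these scales with a squared area. -/
theorem norm_charFun_quadTreeTransform_sub_le {μ ν : Measure ℝ} [IsProbabilityMeasure μ]
    [IsProbabilityMeasure ν] {C : ℝ} (h : ∀ t, ‖charFun μ t - charFun ν t‖ ≤ C * t ^ 2) (t : ℝ) :
    ‖charFun (quadTreeTransform μ) t - charFun (quadTreeTransform ν) t‖ ≤ 4 / 9 * C * t ^ 2 := by
  rw [charFun_quadTreeTransform, charFun_quadTreeTransform,
    ← integral_sub (integrable_charFun_integrand μ t) (integrable_charFun_integrand ν t)]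
  obtain ⟨hi, he⟩ := integral_sum_quadrantArea_sq
  calc _ ≤ ∫ p : ℝ × ℝ, C * t ^ 2 * ∑ i, quadrantArea p.1 p.2 i ^ 2 ∂(unifLaw.prod unifLaw) := by
        refine norm_integral_le_of_norm_le (hi.const_mul _) (ae_of_all _ fun p => ?_)
        rw [← mul_sub, norm_mul, ← Complex.ofReal_mul, Complex.norm_exp_ofReal_mul_I, one_mul,
          Finset.mul_sum]
        refine (norm_prod_sub_prod_le_sum _ (fun i => norm_charFun_le_one _)
          fun i => norm_charFun_le_one _).trans (Finset.sum_le_sum fun i _ => ?_)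
        refine (h _).trans_eq (by ring)
    _ = _ := by rw [integral_const_mul, he]; ring

theorem norm_cexp_sub_one_sub_le (y : ℝ) :
    ‖Complex.exp (y * Complex.I) - 1 - y * Complex.I‖ ≤ 3 * y ^ 2 := by
  have hn : ‖(y : ℂ) * Complex.I‖ = |y| := by simp
  rcases le_total |y| 1 with h | h
  · have := Complex.norm_exp_sub_one_sub_id_le (x := y * Complex.I) (by rwa [hn])
    rw [hn, sq_abs] at this
    nlinarith [sq_nonneg y]
  · calc _ ≤ ‖Complex.exp (y * Complex.I)‖ + ‖(1 : ℂ)‖ + ‖(y : ℂ) * Complex.I‖ :=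
          (norm_sub_le _ _).trans (add_le_add_left (norm_sub_le _ _) _)
      _ = 2 + |y| := by rw [Complex.norm_exp_ofReal_mul_I, norm_one, hn]; ring
      _ ≤ 3 * y ^ 2 := by rw [← sq_abs]; nlinarith

/-- Mean zero removes the first-order term, so the distance scaled by t² is finite and the
contraction has a starting point. -/
theorem exists_norm_charFun_sub_one_le {μ : Measure ℝ} [IsProbabilityMeasure μ]
    (h2 : MemLp (fun x : ℝ => x) 2 μ) (h0 : ∫ x, x ∂μ = 0) :
    ∃ C, ∀ t, ‖charFun μ t - 1‖ ≤ C * t ^ 2 := by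
  have hi : Integrable (fun x : ℝ => x) μ := h2.integrable (by norm_num)
  have hsq : Integrable (fun x : ℝ => x ^ 2) μ := h2.integrable_sq
  refine ⟨3 * ∫ x, x ^ 2 ∂μ, fun t => ?_⟩
  have hint : Integrable (fun x : ℝ => Complex.exp (t * x * Complex.I)) μ := by
    refine Integrable.of_bound (C := 1) (by fun_prop) (ae_of_all _ fun x => ?_)
    rw [← Complex.ofReal_mul, Complex.norm_exp_ofReal_mul_I]
  have hlin : Integrable (fun x : ℝ => ((t * x : ℝ) : ℂ) * Complex.I) μ :=
    ((hi.const_mul t).ofReal).mul_const _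
  have he : charFun μ t - 1 = ∫ x : ℝ, (Complex.exp (t * x * Complex.I) - 1
      - ((t * x : ℝ) : ℂ) * Complex.I) ∂μ := by
    have hint1 : Integrable (fun x : ℝ => Complex.exp (t * x * Complex.I) - 1) μ :=
      hint.sub (integrable_const _)
    rw [integral_sub hint1 hlin, integral_sub hint (integrable_const _),
      charFun_apply_real, integral_mul_const, integral_complex_ofReal, integral_const_mul, h0]
    simp
  rw [he]
  calc _ ≤ ∫ x, 3 * t ^ 2 * x ^ 2 ∂μ := by
        refine norm_integral_le_of_norm_le (hsq.const_mul _) (ae_of_all _ fun x => ?_)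
        have := norm_cexp_sub_one_sub_le (t * x)
        push_cast at this ⊢
        refine this.trans_eq (by ring)
    _ = _ := by rw [integral_const_mul]; ring

theorem IsQuadTreeLaw.unique {μ ν : Measure ℝ} (hμ : IsQuadTreeLaw μ) (hν : IsQuadTreeLaw ν) :
    μ = ν := by
  have := hμ.isProbabilityMeasure
  have := hν.isProbabilityMeasure
  obtain ⟨C, hC⟩ := exists_norm_charFun_sub_one_le hμ.memLp_two hμ.mean_zero
  obtain ⟨D, hD⟩ := exists_norm_charFun_sub_one_le hν.memLp_two hν.mean_zero
  have key : ∀ n : ℕ, ∀ t, ‖charFun μ t - charFun ν t‖ ≤ (4 / 9) ^ n * (C + D) * t ^ 2 := by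
    intro n
    induction n with
    | zero =>
      intro t
      have := norm_sub_le (charFun μ t - 1) (charFun ν t - 1)
      rw [sub_sub_sub_cancel_right] at this
      linarith [hC t, hD t]
    | succ n ih =>
      intro t
      have := norm_charFun_quadTreeTransform_sub_le ih t
      rw [hμ.fixedPoint, hν.fixedPoint] at this
      exact this.trans_eq (by ring)
  refine Measure.ext_of_charFun (funext fun t => ?_)
  have hlim : Tendsto (fun n : ℕ => (4 / 9 : ℝ) ^ n * (C + D) * t ^ 2) atTop (𝓝 0) := by
    have := ((tendsto_pow_atTop_nhds_zero_of_lt_one (r := (4 / 9 : ℝ)) (by norm_num)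
      (by norm_num)).mul_const (C + D)).mul_const (t ^ 2)
    simpa using this
  have := ge_of_tendsto' hlim fun n => key n t
  exact sub_eq_zero.1 (norm_le_zero_iff.1 this)

/-! ### Existence of a solution that satisfies the moment bounds. -/

/-- Both one-sided moment generating function bounds. -/
def HasTwoSidedMGFBound (μ : Measure ℝ) : Prop :=
  HasMGFBound 1 (1 / 2) μ ∧ HasMGFBound (-1) (Real.log 2 - 1 / 2) μ

theorem HasMGFBound.mul_integral_nonpos {σ a : ℝ} {μ : Measure ℝ} [IsProbabilityMeasure μ]
    (h : HasMGFBound σ a μ) (hi : Integrable (fun x : ℝ => x) μ) : σ * ∫ x, x ∂μ ≤ 0 := by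
  set m := ∫ x, x ∂μ with hm
  have hle : ∀ s : ℝ, 0 ≤ s → 1 + σ * s * m ≤ Real.exp (cgfBound a s) := by
    intro s hs
    refine le_trans ?_ (h.integral_le hs)
    calc 1 + σ * s * m = ∫ x, (1 + σ * s * x) ∂μ := by
          rw [integral_add (integrable_const _) (hi.const_mul _), integral_const_mul]
          simp [hm]
      _ ≤ _ := integral_mono ((integrable_const _).add (hi.const_mul _)) (h.integrable hs)
          fun x => by simpa [add_comm] using Real.add_one_le_exp (σ * s * x)
  -- K has derivative 0 at 0. The function equals 1 at 0 and is at least 1 for s ≥ 0, so its right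
  -- derivative -σm is nonnegative.
  have hd : HasDerivAt (fun s : ℝ => Real.exp (cgfBound a s) - σ * s * m) (-(σ * m)) 0 := by
    have h1 : HasDerivAt (fun s : ℝ => a * s) a 0 := by
      simpa using (hasDerivAt_id (0 : ℝ)).const_mul a
    have h2 : HasDerivAt (fun s : ℝ => cgfBound a s) 0 0 := by
      unfold cgfBound
      refine (((h1.exp.sub_const 1).sub h1).const_mul 10000).congr_deriv ?_
      simp
    have h3 : HasDerivAt (fun s : ℝ => σ * s * m) (σ * m) 0 := by
      simpa using ((hasDerivAt_id (0 : ℝ)).const_mul σ).mul_const m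
    exact (h2.exp.sub h3).congr_deriv (by simp)
  have := ge_of_tendsto hd.tendsto_slope_zero_right (b := 0) (by
    filter_upwards [self_mem_nhdsWithin] with s hs
    have hs' : 0 < s := hs
    have := hle s hs'.le
    refine mul_nonneg (inv_nonneg.2 hs'.le) ?_
    simp [cgfBound] at this ⊢
    linarith)
  linarith

theorem HasTwoSidedMGFBound.memLp_two {μ : Measure ℝ} (h : HasTwoSidedMGFBound μ) :
    MemLp (fun x : ℝ => x) 2 μ := by
  rw [memLp_two_iff_integrable_sq (by fun_prop)]
  refine (((h.1.integrable zero_le_one).add (h.2.integrable zero_le_one)).const_mul 2).mono'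
    (by fun_prop) (ae_of_all _ fun x => ?_)
  rw [Real.norm_eq_abs, abs_of_nonneg (sq_nonneg x)]
  simp only [Pi.add_apply, mul_one, one_mul, neg_mul]
  have h1 := Real.exp_pos x
  have h2 := Real.exp_pos (-x)
  rcases le_total 0 x with hx | hx
  · have := Real.quadratic_le_exp_of_nonneg hx
    linarith
  · have := Real.quadratic_le_exp_of_nonneg (neg_nonneg.2 hx)
    rw [neg_sq] at this
    linarith

theorem HasTwoSidedMGFBound.mean_zero {μ : Measure ℝ} [IsProbabilityMeasure μ]
    (h : HasTwoSidedMGFBound μ) : ∫ x, x ∂μ = 0 := by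
  have hi : Integrable (fun x : ℝ => x) μ := h.memLp_two.integrable (by norm_num)
  have h1 := h.1.mul_integral_nonpos hi
  have h2 := h.2.mul_integral_nonpos hi
  linarith

theorem isTightMeasureSet_twoSidedMGFBound :
    IsTightMeasureSet {μ : Measure ℝ | HasTwoSidedMGFBound μ} := by
  rw [isTightMeasureSet_iff_exists_isCompact_measure_compl_le]
  intro ε hε
  set B := ENNReal.ofReal (Real.exp (cgfBound (1 / 2) 1)) +
    ENNReal.ofReal (Real.exp (cgfBound (Real.log 2 - 1 / 2) 1)) with hB
  have hBtop : B ≠ ⊤ := by simp [hB]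
  have hlim : Tendsto (fun r : ℝ => B / ENNReal.ofReal (Real.exp r)) atTop (𝓝 0) := by
    have := ENNReal.Tendsto.const_div (a := B)
      (ENNReal.tendsto_ofReal_nhds_top.2 Real.tendsto_exp_atTop) (Or.inr hBtop)
    simpa using this
  obtain ⟨r, hr⟩ := (hlim.eventually_lt_const hε).exists
  refine ⟨Set.Icc (-r) r, isCompact_Icc, fun μ hμ => ?_⟩
  have h1 := hμ.1 1 zero_le_one
  have h2 := hμ.2 1 zero_le_one
  have hint : ∫⁻ x, (ENNReal.ofReal (Real.exp (1 * 1 * x)) +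
      ENNReal.ofReal (Real.exp (-1 * 1 * x))) ∂μ ≤ B := by
    rw [lintegral_add_left (by fun_prop)]
    exact add_le_add h1 h2
  refine le_trans ?_ hr.le
  have hsub : (Set.Icc (-r) r)ᶜ ⊆ {x | ENNReal.ofReal (Real.exp r) ≤
      ENNReal.ofReal (Real.exp (1 * 1 * x)) + ENNReal.ofReal (Real.exp (-1 * 1 * x))} := by
    intro x hx
    rw [Set.mem_compl_iff, Set.mem_Icc, not_and_or, not_le, not_le] at hx
    rcases hx with hx | hx
    · refine le_trans (ENNReal.ofReal_le_ofReal (Real.exp_le_exp.2 ?_)) le_add_self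
      linarith
    · refine le_trans (ENNReal.ofReal_le_ofReal (Real.exp_le_exp.2 ?_)) le_self_add
      linarith
  refine (measure_mono hsub).trans ((meas_ge_le_lintegral_div (by fun_prop) ?_ (by simp)).trans
    (ENNReal.div_le_div_right hint _))
  simpa using Real.exp_pos r

/-- The exponential is unbounded, so weak convergence gives no limit of the integrals. For
nonnegative continuous integrands it still gives lower semicontinuity, which is the direction
needed. -/
theorem HasMGFBound.of_tendsto {σ a : ℝ} {μs : ℕ → ProbabilityMeasure ℝ} {μ : ProbabilityMeasure ℝ}
    (h : ∀ n, HasMGFBound σ a (μs n)) (hlim : Tendsto μs atTop (𝓝 μ)) : HasMGFBound σ a μ := by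
  intro s hs
  refine (lintegral_le_liminf_lintegral_of_forall_isOpen_measure_le_liminf_measure
    (μs := fun n => (μs n : Measure ℝ)) (by fun_prop) (fun x => (Real.exp_pos _).le)
    fun G hG => ProbabilityMeasure.le_liminf_measure_open_of_tendsto hlim hG).trans ?_
  exact liminf_le_of_le (by isBoundedDefault) fun b hb =>
    let ⟨n, hn⟩ := hb.exists
    hn.trans (h n s hs)

theorem hasMGFBound_dirac_zero (σ a : ℝ) : HasMGFBound σ a (Measure.dirac 0) := by
  intro s _
  rw [lintegral_dirac]
  refine ENNReal.ofReal_le_ofReal (Real.exp_le_exp.2 ?_)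
  have := Real.add_one_le_exp (a * s)
  rw [mul_zero, cgfBound]
  linarith

theorem HasTwoSidedMGFBound.quadTreeTransform {μ : Measure ℝ} [IsProbabilityMeasure μ]
    (h : HasTwoSidedMGFBound μ) : HasTwoSidedMGFBound (quadTreeTransform μ) :=
  ⟨h.1.quadTreeTransform isTollBound_one, h.2.quadTreeTransform isTollBound_neg_one⟩

/-- The smoothing transform on probability measures. -/
noncomputable def quadTreeStep (μ : ProbabilityMeasure ℝ) : ProbabilityMeasure ℝ :=
  ⟨quadTreeTransform μ, quadTreeTransform_isProbabilityMeasure μ⟩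

/-- The iterates of the smoothing transform from the point mass at `0`. -/
noncomputable def quadTreeIter : ℕ → ProbabilityMeasure ℝ
  | 0 => ⟨Measure.dirac 0, inferInstance⟩
  | n + 1 => quadTreeStep (quadTreeIter n)

theorem quadTreeIter_succ (n : ℕ) :
    (quadTreeIter (n + 1) : Measure ℝ) = quadTreeTransform (quadTreeIter n) := rfl

theorem hasTwoSidedMGFBound_quadTreeIter (n : ℕ) :
    HasTwoSidedMGFBound (quadTreeIter n : Measure ℝ) := by
  induction n with
  | zero => exact ⟨hasMGFBound_dirac_zero _ _, hasMGFBound_dirac_zero _ _⟩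
  | succ n ih => rw [quadTreeIter_succ]; exact ih.quadTreeTransform

theorem exists_norm_charFun_quadTreeIter_sub_le : ∃ C, ∀ (n : ℕ) (t : ℝ),
    ‖charFun (quadTreeIter n : Measure ℝ) t - charFun (quadTreeIter (n + 1) : Measure ℝ) t‖ ≤
      C * t ^ 2 * (4 / 9) ^ n := by
  have h1 := hasTwoSidedMGFBound_quadTreeIter 1
  obtain ⟨C, hC⟩ := exists_norm_charFun_sub_one_le h1.memLp_two h1.mean_zero
  have key : ∀ (n : ℕ) (t : ℝ), ‖charFun (quadTreeIter n : Measure ℝ) t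
      - charFun (quadTreeIter (n + 1) : Measure ℝ) t‖ ≤ C * (4 / 9) ^ n * t ^ 2 := by
    intro n
    induction n with
    | zero =>
      intro t
      have h0 : charFun (quadTreeIter 0 : Measure ℝ) t = 1 := by
        change charFun (Measure.dirac (0 : ℝ)) t = 1
        simp
      rw [h0, norm_sub_rev]
      simpa using hC t
    | succ n ih =>
      intro t
      have := norm_charFun_quadTreeTransform_sub_le ih t
      rw [← quadTreeIter_succ, ← quadTreeIter_succ] at this
      exact this.trans_eq (by ring)
  exact ⟨C, fun n t => (key n t).trans_eq (by ring)⟩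

theorem exists_isQuadTreeLaw : ∃ μ : Measure ℝ, IsQuadTreeLaw μ ∧ HasTwoSidedMGFBound μ := by
  have hcomp : IsCompact (closure (Set.range quadTreeIter)) := by
    refine isCompact_closure_of_isTightMeasureSet (isTightMeasureSet_twoSidedMGFBound.subset ?_)
    rintro _ ⟨_, ⟨n, rfl⟩, rfl⟩
    exact hasTwoSidedMGFBound_quadTreeIter n
  obtain ⟨μ, -, φ, hφ, hlim⟩ := hcomp.tendsto_subseq
    (x := quadTreeIter) fun n => subset_closure ⟨n, rfl⟩
  have hbd : HasTwoSidedMGFBound (μ : Measure ℝ) :=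
    ⟨HasMGFBound.of_tendsto (fun n => (hasTwoSidedMGFBound_quadTreeIter (φ n)).1) hlim,
      HasMGFBound.of_tendsto (fun n => (hasTwoSidedMGFBound_quadTreeIter (φ n)).2) hlim⟩
  obtain ⟨C, hC⟩ := exists_norm_charFun_quadTreeIter_sub_le
  -- Compactness yields only a subsequence, along which a step of the transform need not have the
  -- same limit. The geometric Cauchy bound extends convergence to all iterates, so the shifted
  -- sequence converges as well.
  have hchar : ∀ t, Tendsto (fun n => charFun (quadTreeIter n : Measure ℝ) t) atTop
      (𝓝 (charFun (μ : Measure ℝ) t)) := by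
    intro t
    have hcau : CauchySeq fun n => charFun (quadTreeIter n : Measure ℝ) t :=
      cauchySeq_of_le_geometric (4 / 9) (C * t ^ 2) (by norm_num)
        fun n => by rw [dist_eq_norm]; exact hC n t
    exact tendsto_nhds_of_cauchySeq_of_subseq hcau hφ.tendsto_atTop
      (ProbabilityMeasure.tendsto_iff_tendsto_charFun.1 hlim t)
  refine ⟨μ, ⟨inferInstance, hbd.memLp_two, hbd.mean_zero, ?_⟩, hbd⟩
  have := quadTreeTransform_isProbabilityMeasure μ
  refine Measure.ext_of_charFun (funext fun t => ?_)
  refine tendsto_nhds_unique ?_ ((tendsto_add_atTop_iff_nat 1).2 (hchar t))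
  simp_rw [quadTreeIter_succ, charFun_quadTreeTransform]
  refine tendsto_integral_of_dominated_convergence (fun _ => 1)
    (fun n => (integrable_charFun_integrand _ t).aestronglyMeasurable) (integrable_const _)
    (fun n => ae_of_all _ fun p => ?_) (ae_of_all _ fun p => ?_)
  · rw [norm_mul, ← Complex.ofReal_mul, Complex.norm_exp_ofReal_mul_I, one_mul, norm_prod]
    exact Finset.prod_le_one (fun i _ => norm_nonneg _) fun i _ => norm_charFun_le_one _
  · exact (tendsto_finsetProd _ fun i _ => hchar _).const_mul _

theorem existsUnique_isQuadTreeLaw : ∃! ν : Measure ℝ, IsQuadTreeLaw ν := by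
  obtain ⟨μ, hμ, -⟩ := exists_isQuadTreeLaw
  exact ⟨μ, hμ, fun ν hν => hν.unique hμ⟩

theorem IsQuadTreeLaw.hasTwoSidedMGFBound {ν : Measure ℝ} (hν : IsQuadTreeLaw ν) :
    HasTwoSidedMGFBound ν := by
  obtain ⟨μ, hμ, h⟩ := exists_isQuadTreeLaw
  rwa [hν.unique hμ]

/-! ### Chernoff bounds for both tails. -/

theorem HasMGFBound.measure_tail_le {σ a : ℝ} {ν : Measure ℝ} (h : HasMGFBound σ a ν)
    (ha : 0 < a) {x : ℝ} (hx : 1 ≤ x) :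
    ν {z | x < σ * z} ≤ ENNReal.ofReal (Real.exp (10000 * x - a⁻¹ * (x * Real.log x))) := by
  -- With this choice exp(as) = x, so K(s) is at most linear in x while sx = x log x / a.
  set s := Real.log x / a with hs
  have hs0 : 0 ≤ s := div_nonneg (Real.log_nonneg hx) ha.le
  have has : a * s = Real.log x := by rw [hs]; field_simp
  have hsub : {z | x < σ * z} ⊆
      {z | ENNReal.ofReal (Real.exp (s * x)) ≤ ENNReal.ofReal (Real.exp (σ * s * z))} := by
    intro z hz
    have hz' : x < σ * z := hz
    refine ENNReal.ofReal_le_ofReal (Real.exp_le_exp.2 ?_)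
    nlinarith
  have hpos : 0 < Real.exp (s * x) := Real.exp_pos _
  refine (measure_mono hsub).trans ((meas_ge_le_lintegral_div (by fun_prop) (by simpa using hpos)
    (by simp)).trans ((ENNReal.div_le_div_right (h s hs0) _).trans ?_))
  rw [← ENNReal.ofReal_div_of_pos hpos, ← Real.exp_sub]
  refine ENNReal.ofReal_le_ofReal (Real.exp_le_exp.2 ?_)
  rw [cgfBound, has, Real.exp_log (by linarith)]
  have h1 := Real.log_nonneg hx
  have h2 : s * x = a⁻¹ * (x * Real.log x) := by rw [hs]; field_simp
  linarith

theorem limsup_log_div_le {φ : ℝ → ENNReal} {f d : ℝ → ℝ} {L : ℝ}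
    (hφ : ∀ᶠ x in atTop, φ x ≤ ENNReal.ofReal (Real.exp (f x))) (hd : ∀ᶠ x in atTop, 0 < d x)
    (hf : Tendsto (fun x => f x / d x) atTop (𝓝 L)) :
    limsup (fun x => ENNReal.log (φ x) / ((d x : ℝ) : EReal)) atTop ≤ (L : EReal) := by
  rw [← ((continuous_coe_real_ereal.tendsto L).comp hf).limsup_eq]
  refine limsup_le_limsup ?_
  filter_upwards [hφ, hd] with x hx hdx
  have h1 := ENNReal.log_le_log hx
  rw [ENNReal.log_ofReal_of_pos (Real.exp_pos _), Real.log_exp] at h1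
  rw [Function.comp_apply, EReal.coe_div]
  exact EReal.div_le_div_right_of_nonneg (EReal.coe_nonneg.2 hdx.le) h1

theorem le_liminf_log_div {φ : ℝ → ENNReal} {f d : ℝ → ℝ} {L : ℝ}
    (hφ : ∀ᶠ x in atTop, ENNReal.ofReal (Real.exp (f x)) ≤ φ x) (hd : ∀ᶠ x in atTop, 0 < d x)
    (hf : Tendsto (fun x => f x / d x) atTop (𝓝 L)) :
    (L : EReal) ≤ liminf (fun x => ENNReal.log (φ x) / ((d x : ℝ) : EReal)) atTop := by
  rw [← ((continuous_coe_real_ereal.tendsto L).comp hf).liminf_eq]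
  refine liminf_le_liminf ?_
  filter_upwards [hφ, hd] with x hx hdx
  have h1 := ENNReal.log_le_log hx
  rw [ENNReal.log_ofReal_of_pos (Real.exp_pos _), Real.log_exp] at h1
  rw [Function.comp_apply, EReal.coe_div]
  exact EReal.div_le_div_right_of_nonneg (EReal.coe_nonneg.2 hdx.le) h1

theorem eventually_mul_log_pos : ∀ᶠ x : ℝ in atTop, 0 < x * Real.log x := by
  filter_upwards [eventually_gt_atTop 1] with x hx
  exact mul_pos (by linarith) (Real.log_pos hx)

theorem HasMGFBound.limsup_log_tail_le {σ a : ℝ} {ν : Measure ℝ} (h : HasMGFBound σ a ν)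
    (ha : 0 < a) :
    limsup (fun x : ℝ => ENNReal.log (ν {z | x < σ * z}) / ((x * Real.log x : ℝ) : EReal)) atTop
      ≤ ((-a⁻¹ : ℝ) : EReal) := by
  refine limsup_log_div_le (f := fun x => 10000 * x - a⁻¹ * (x * Real.log x)) ?_
    eventually_mul_log_pos ?_
  · filter_upwards [eventually_ge_atTop 1] with x hx using h.measure_tail_le ha hx
  · have h1 : Tendsto (fun x : ℝ => 10000 / Real.log x - a⁻¹) atTop (𝓝 (-a⁻¹)) := by
      simpa using (Real.tendsto_log_atTop.const_div_atTop 10000).sub_const a⁻¹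
    refine h1.congr' ?_
    filter_upwards [eventually_gt_atTop 1] with x hx
    have := Real.log_pos hx
    have : 0 < x := by linarith
    field_simp

/-! ### Lower bound for the right tail. -/

theorem IsQuadTreeLaw.measureReal_Ici_zero_pos {ν : Measure ℝ} (hν : IsQuadTreeLaw ν) :
    0 < ν.real (Set.Ici 0) := by
  have := hν.isProbabilityMeasure
  refine measureReal_nonneg.lt_of_ne fun h0 => ?_
  have hz : ν (Set.Ici 0) = 0 := (measureReal_eq_zero_iff).1 h0.symm
  have hae : ∀ᵐ x ∂ν, x < 0 := by
    refine measure_mono_null (fun x hx => ?_) hz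
    simpa using hx
  have hi : Integrable (fun x : ℝ => x) ν := hν.memLp_two.integrable (by norm_num)
  have h2 := (integral_eq_zero_iff_of_nonneg_ae (f := fun x : ℝ => -x)
    (by filter_upwards [hae] with x hx using by simpa using hx.le) hi.neg).1
    (by rw [integral_neg, hν.mean_zero, neg_zero])
  obtain ⟨x, hx1, hx2⟩ := (hae.and h2).exists
  simp at hx2
  linarith

theorem binEntropy_le_of_mem {δ u : ℝ} (hδ : δ ≤ 1 / 2) (hu : u ∈ Set.Ioo (1 - δ) 1) :
    Real.binEntropy u ≤ Real.binEntropy δ := by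
  rw [← Real.binEntropy_one_sub u]
  exact Real.binEntropy_strictMonoOn.monotoneOn
    ⟨by linarith [hu.2], by norm_num; linarith [hu.1]⟩
    ⟨by linarith [hu.1, hu.2], by norm_num; linarith⟩ (by linarith [hu.1])

/-- On the event that both uniforms exceed 1 - δ, the first copy is at least y and the others are
nonnegative, the first area is at least 1 - 2δ and the toll at least 1 - 2H(δ), with H the binary
entropy. -/
theorem IsQuadTreeLaw.measureReal_Ici_step {ν : Measure ℝ} (hν : IsQuadTreeLaw ν) {δ y : ℝ}
    (hδ0 : 0 < δ) (hδ : δ ≤ 1 / 2) (hy : 0 ≤ y) :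
    δ ^ 2 * ν.real (Set.Ici 0) ^ 3 * ν.real (Set.Ici y) ≤
      ν.real (Set.Ici (y + (1 - 2 * δ * y - 2 * Real.binEntropy δ))) := by
  have := hν.isProbabilityMeasure
  set y' := y + (1 - 2 * δ * y - 2 * Real.binEntropy δ) with hy'
  set R : Set ((ℝ × ℝ) × (Fin 4 → ℝ)) := (Set.Ioo (1 - δ) 1 ×ˢ Set.Ioo (1 - δ) 1) ×ˢ
    Set.univ.pi (fun i : Fin 4 => (![Set.Ici y, Set.Ici 0, Set.Ici 0, Set.Ici 0] i : Set ℝ)) with hR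
  have hsub : R ⊆ quadTreeRHS ⁻¹' Set.Ici y' := by
    rintro ⟨⟨u, v⟩, x⟩ ⟨⟨hu, hv⟩, hx⟩
    have h0 : y ≤ x 0 := hx 0 trivial
    have h1 : 0 ≤ x 1 := hx 1 trivial
    have h2 : 0 ≤ x 2 := hx 2 trivial
    have h3 : 0 ≤ x 3 := hx 3 trivial
    have hu0 : 1 - δ < u := hu.1
    have hv0 : 1 - δ < v := hv.1
    have hu1 : u < 1 := hu.2
    have hv1 : v < 1 := hv.2
    have hbu := binEntropy_le_of_mem hδ hu
    have hbv := binEntropy_le_of_mem hδ hv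
    have huv : 1 - 2 * δ ≤ u * v := by nlinarith
    have t0 : (1 - 2 * δ) * y ≤ u * v * x 0 := mul_le_mul huv h0 hy (by nlinarith)
    have t1 : 0 ≤ u * (1 - v) * x 1 :=
      mul_nonneg (mul_nonneg (by linarith) (by linarith)) h1
    have t2 : 0 ≤ (1 - u) * v * x 2 :=
      mul_nonneg (mul_nonneg (by linarith) (by linarith)) h2
    have t3 : 0 ≤ (1 - u) * (1 - v) * x 3 :=
      mul_nonneg (mul_nonneg (by linarith) (by linarith)) h3
    simp only [Set.mem_preimage, Set.mem_Ici, quadTreeRHS]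
    rw [quadTreeToll_eq ⟨by linarith, hu1⟩ ⟨by linarith, hv1⟩]
    linarith
  have hvol : unifLaw (Set.Ioo (1 - δ) 1) = ENNReal.ofReal δ := by
    rw [unifLaw, Measure.restrict_apply measurableSet_Ioo,
      Set.inter_eq_left.2 (Set.Ioo_subset_Ioo_left (by linarith)), Real.volume_Ioo]
    simp
  have hmeas : ((unifLaw.prod unifLaw).prod (Measure.pi fun _ : Fin 4 => ν)) R =
      ENNReal.ofReal δ * ENNReal.ofReal δ *
        (ν (Set.Ici y) * ν (Set.Ici 0) * ν (Set.Ici 0) * ν (Set.Ici 0)) := by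
    rw [hR, Measure.prod_prod, Measure.prod_prod, hvol, Measure.pi_pi, Fin.prod_univ_four]
    simp
  have hle : ((unifLaw.prod unifLaw).prod (Measure.pi fun _ : Fin 4 => ν)) R ≤ ν (Set.Ici y') := by
    conv_rhs => rw [← hν.fixedPoint]
    rw [quadTreeTransform, Measure.map_apply measurable_quadTreeRHS measurableSet_Ici]
    exact measure_mono hsub
  rw [hmeas] at hle
  have := ENNReal.toReal_mono (measure_ne_top _ _) hle
  simp only [ENNReal.toReal_mul, ENNReal.toReal_ofReal hδ0.le] at this
  simp only [Measure.real]
  refine le_trans (le_of_eq (by ring)) this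

theorem IsQuadTreeLaw.eventually_measureReal_Ici_ge {ν : Measure ℝ} (hν : IsQuadTreeLaw ν) {ε : ℝ}
    (hε0 : 0 < ε) (hε1 : ε < 1) : ∀ᶠ n : ℕ in atTop,
      ν.real (Set.Ici 0) * ((ε / 4 / n) ^ 2 * ν.real (Set.Ici 0) ^ 3) ^ n ≤
        ν.real (Set.Ici (n * (1 - ε))) := by
  have := hν.isProbabilityMeasure
  have hp := hν.measureReal_Ici_zero_pos
  have hlim0 : Tendsto (fun n : ℕ => ε / 4 / n) atTop (𝓝 0) :=
    tendsto_const_div_atTop_nhds_zero_nat _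
  have hlim : Tendsto (fun n : ℕ => Real.binEntropy (ε / 4 / n)) atTop (𝓝 0) := by
    have h := (Real.binEntropy_continuous.tendsto 0).comp hlim0
    rwa [Real.binEntropy_zero] at h
  filter_upwards [eventually_gt_atTop 0, hlim.eventually_lt_const (by linarith : 0 < ε / 4)]
    with n hn hb
  have hn' : (1 : ℝ) ≤ n := by exact_mod_cast hn
  -- Levels stay below n, so 2δy ≤ ε/2. Since also 2H(δ) ≤ ε/2, each of the n steps gains at least 1
  -- - ε.
  set δ := ε / 4 / n with hδ
  have hδ0 : 0 < δ := by positivity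
  have hδn : δ * n = ε / 4 := by rw [hδ]; field_simp
  have hδ1 : δ ≤ 1 / 2 := by nlinarith
  have key : ∀ k : ℕ, k ≤ n → ν.real (Set.Ici 0) * (δ ^ 2 * ν.real (Set.Ici 0) ^ 3) ^ k ≤
      ν.real (Set.Ici (k * (1 - ε))) := by
    intro k
    induction k with
    | zero => simp
    | succ k ih =>
      intro hk
      have hkn : (k : ℝ) ≤ n := by exact_mod_cast (Nat.le_of_succ_le hk)
      have hy : 0 ≤ k * (1 - ε) := mul_nonneg (Nat.cast_nonneg k) (by linarith)
      have hyn : k * (1 - ε) ≤ n := by nlinarith [(Nat.cast_nonneg k : (0 : ℝ) ≤ k)]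
      have hs := hν.measureReal_Ici_step hδ0 hδ1 hy
      calc _ = δ ^ 2 * ν.real (Set.Ici 0) ^ 3 *
            (ν.real (Set.Ici 0) * (δ ^ 2 * ν.real (Set.Ici 0) ^ 3) ^ k) := by ring
        _ ≤ δ ^ 2 * ν.real (Set.Ici 0) ^ 3 * ν.real (Set.Ici (k * (1 - ε))) := by
            gcongr
            exact ih (Nat.le_of_succ_le hk)
        _ ≤ _ := hs
        _ ≤ _ := by
            refine measureReal_mono (Set.Ici_subset_Ici.2 ?_)
            push_cast
            nlinarith
  exact key n le_rfl

/-- With n the integer in the statement, n/x → r and log n = log(n/x) + log x. Only -2n log n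
survives division by x log x. -/
theorem tendsto_lower_exponent {r : ℝ} (hr : 0 < r) (A B : ℝ) :
    Tendsto (fun x : ℝ => (A + (⌊r * x⌋₊ + 1 : ℕ) * (B - 2 * Real.log (⌊r * x⌋₊ + 1 : ℕ))) /
      (x * Real.log x)) atTop (𝓝 (-(2 * r))) := by
  have h1 : Tendsto (fun x : ℝ => ((⌊r * x⌋₊ + 1 : ℕ) : ℝ) / x) atTop (𝓝 r) := by
    have := (tendsto_nat_floor_mul_div_atTop (R := ℝ) hr.le).add tendsto_inv_atTop_zero
    rw [add_zero] at this
    refine this.congr fun x => ?_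
    push_cast
    ring
  have hlog := Real.tendsto_log_atTop
  have h2 : Tendsto (fun x : ℝ => Real.log (((⌊r * x⌋₊ + 1 : ℕ) : ℝ) / x) / Real.log x) atTop
      (𝓝 0) := ((Real.continuousAt_log hr.ne').tendsto.comp h1).div_atTop hlog
  have h3 := hlog.const_div_atTop B
  have h4 : Tendsto (fun x : ℝ => A / (x * Real.log x)) atTop (𝓝 0) :=
    (tendsto_id.atTop_mul_atTop₀ hlog).const_div_atTop A
  have h5 := h4.add (h1.mul (h3.sub ((h2.add_const 1).const_mul 2)))
  rw [show (0 : ℝ) + r * (0 - 2 * (0 + 1)) = -(2 * r) by ring] at h5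
  refine h5.congr' ?_
  filter_upwards [eventually_gt_atTop 1] with x hx
  have hl := Real.log_pos hx
  have hx0 : 0 < x := by linarith
  rw [Real.log_div (by positivity) hx0.ne']
  field_simp
  ring

theorem IsQuadTreeLaw.le_liminf_log_tail {ν : Measure ℝ} (hν : IsQuadTreeLaw ν) {ε : ℝ}
    (hε0 : 0 < ε) (hε1 : ε < 1) : ((-(2 * (1 - ε)⁻¹) : ℝ) : EReal) ≤
      liminf (fun x : ℝ => ENNReal.log (ν (Set.Ioi x)) / ((x * Real.log x : ℝ) : EReal)) atTop := by
  have := hν.isProbabilityMeasure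
  have hp := hν.measureReal_Ici_zero_pos
  have hr : 0 < (1 - ε)⁻¹ := inv_pos.2 (by linarith)
  refine le_liminf_log_div ?_ eventually_mul_log_pos (tendsto_lower_exponent hr
    (Real.log (ν.real (Set.Ici 0)))
    (2 * Real.log (ε / 4) + 3 * Real.log (ν.real (Set.Ici 0))))
  have hn : Tendsto (fun x : ℝ => ⌊(1 - ε)⁻¹ * x⌋₊ + 1) atTop atTop :=
    (tendsto_add_atTop_nat 1).comp
      (tendsto_nat_floor_atTop.comp (tendsto_id.const_mul_atTop hr))
  filter_upwards [hn.eventually (hν.eventually_measureReal_Ici_ge hε0 hε1)] with x hx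
  -- The extra 1 makes n(1-ε) strictly larger than x, as the open tail requires.
  set n := ⌊(1 - ε)⁻¹ * x⌋₊ + 1 with hn_def
  have hn0 : (0 : ℝ) < n := by rw [hn_def]; positivity
  have hxn : x < n * (1 - ε) := by
    have := Nat.lt_floor_add_one ((1 - ε)⁻¹ * x)
    rw [inv_mul_lt_iff₀ (by linarith)] at this
    rw [hn_def]
    push_cast
    linarith
  have hexp : Real.exp (Real.log (ν.real (Set.Ici 0)) + n * (2 * Real.log (ε / 4) +
      3 * Real.log (ν.real (Set.Ici 0)) - 2 * Real.log n)) =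
      ν.real (Set.Ici 0) * ((ε / 4 / n) ^ 2 * ν.real (Set.Ici 0) ^ 3) ^ n := by
    rw [← Real.exp_log (x := ν.real (Set.Ici 0) * ((ε / 4 / n) ^ 2 * ν.real (Set.Ici 0) ^ 3) ^ n)
      (by positivity), Real.log_mul (by positivity) (by positivity), Real.log_pow,
      Real.log_mul (by positivity) (by positivity), Real.log_pow, Real.log_pow,
      Real.log_div (x := ε / 4) (y := n) (by positivity) (by positivity)]
    congr 1
    push_cast
    ring
  rw [hexp]
  calc _ ≤ ENNReal.ofReal (ν.real (Set.Ici (n * (1 - ε)))) := ENNReal.ofReal_le_ofReal hx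
    _ = ν (Set.Ici (n * (1 - ε))) := ofReal_measureReal
    _ ≤ _ := measure_mono fun z hz => lt_of_lt_of_le hxn hz

/-! ### Matching the bounds and conclusion. -/

theorem IsQuadTreeLaw.tendsto_log_tail {ν : Measure ℝ} (hν : IsQuadTreeLaw ν) :
    Tendsto (fun x : ℝ => ENNReal.log (ν (Set.Ioi x)) / ((x * Real.log x : ℝ) : EReal))
        atTop (𝓝 ((-2 : ℝ) : EReal)) := by
  refine tendsto_of_le_liminf_of_limsup_le ?_ ?_
  -- The lower bound holds for every ε in (0, 1); letting ε decrease to 0 gives the sharp constant.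
  · have hlim : Tendsto (fun ε : ℝ => ((-(2 * (1 - ε)⁻¹) : ℝ) : EReal)) (𝓝[>] 0)
        (𝓝 ((-2 : ℝ) : EReal)) := by
      refine (continuous_coe_real_ereal.tendsto _).comp ?_
      have hc : ContinuousAt (fun ε : ℝ => -(2 * (1 - ε)⁻¹)) 0 := by
        fun_prop (disch := norm_num)
      have := hc.tendsto.mono_left (nhdsWithin_le_nhds (s := Set.Ioi 0))
      simpa using this
    refine le_of_tendsto hlim ?_
    filter_upwards [Ioo_mem_nhdsGT (zero_lt_one' ℝ)] with ε hε
    exact hν.le_liminf_log_tail hε.1 hε.2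
  · have h := hν.hasTwoSidedMGFBound.1.limsup_log_tail_le (by norm_num)
    norm_num at h
    simpa [Set.Ioi] using h

theorem mainTheorem7 :
    (∃! ν : Measure ℝ, IsQuadTreeLaw ν) ∧
    ∀ ν : Measure ℝ, IsQuadTreeLaw ν →
      Tendsto (fun x : ℝ => ENNReal.log (ν (Set.Ioi x)) / ((x * Real.log x : ℝ) : EReal))
        atTop (𝓝 ((-2 : ℝ) : EReal)) ∧
      limsup (fun x : ℝ => ENNReal.log (ν (Set.Iio (-x))) / ((x * Real.log x : ℝ) : EReal))
        atTop ≤ ((-(2 / (2 * Real.log 2 - 1)) : ℝ) : EReal) := by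
  refine ⟨existsUnique_isQuadTreeLaw, fun ν hν => ⟨hν.tendsto_log_tail, ?_⟩⟩
  have h := hν.hasTwoSidedMGFBound.2.limsup_log_tail_le (by linarith [Real.log_two_gt_d9])
  have hset : ∀ x : ℝ, {z : ℝ | x < -1 * z} = Set.Iio (-x) := fun x => by
    ext z
    simp [lt_neg]
  have hconst : (Real.log 2 - 1 / 2)⁻¹ = 2 / (2 * Real.log 2 - 1) := by
    have : 0 < Real.log 2 - 1 / 2 := by linarith [Real.log_two_gt_d9]
    rw [show 2 * Real.log 2 - 1 = 2 * (Real.log 2 - 1 / 2) by ring, div_mul_cancel_left₀ two_ne_zero]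
  simpa only [hset, hconst] using h
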